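/- Let $\mathfrak c = 2^{\aleph_0}$ and let $\mathfrak b$ be the bounding number, i.e. the least cardinality of a family $\mathcal F \subseteq {}^{\omega}\omega$ for which there is no $g \in {}^{\omega}\omega$ such that, for every $f \in \mathcal F$, $f(n) \le g(n)$ for all but finitely many $n$. A free ultrafilter $u$ on a countably infinite set $S$ is a P-point if for each partition $(V_n)_{n<\omega}$ of $S$ there is $U \in u$ such that either $U \subseteq V_n$ for some $n$, or $U \cap V_n$ is finite for all $n$. For ultrafilters $u, v$ write $v \le_{RK} u$ if there is a map $h$ with $h^{-1}(A) \in u$ for all $A \in v$. Let $X$ be the (countable) set of all functions $x : \mathbb Q \to \omega$ with $x(r) = 0$ for all but finitely many $r$, and for $\xi \in \mathbb R$ let $h_\xi : X \to X$ be given by $h_\xi(x)(r) = x(r)$ if $r < \xi$ and $h_\xi(x)(r) = 0$ if $r \ge \xi$. Theorem. Assume $\mathfrak b = \mathfrak c$. Then there is an order embedding of the real line into the set of P-points on $\omega$ preordered by $\le_{RK}$. More precisely, there is a P-point $D$ on $X$ such that, with $h_\xi(D) = \{A \subseteq X : h_\xi^{-1}(A) \in D\}$, every $h_\xi(D)$ ($\xi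 \in \mathbb R$) is a P-point on $X$ and, for all $\xi, \eta \in \mathbb R$, $\xi \le \eta$ if and only if $h_\xi(D) \le_{RK} h_\eta(D)$; and for some bijection $e : X \to \omega$ the map $\xi \mapsto e(h_\xi(D))$ is an order embedding, in the same sense, of $\mathbb R$ into the P-points on $\omega$. -/

import Mathlib

/-- The bounding number `𝔟`: the least cardinality of a family of functions `ℕ → ℕ` such that no
single function `g` satisfies `f n ≤ g n` for almost all `n`, for every `f` in the family. -/
noncomputable def boundingNumber : Cardinal.{0} :=
  sInf {κ : Cardinal.{0} | ∃ F : Set (ℕ → ℕ), Cardinal.mk F = κ ∧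
    ¬ ∃ g : ℕ → ℕ, ∀ f ∈ F, ∀ᶠ n in Filter.atTop, f n ≤ g n}

/-- A P-point (on a countable set): a free ultrafilter `u` such that for each partition `(V n)` into
countably many pieces there is `U ∈ u` that is contained in one piece or has finite intersection
with all of them. (Some `V n` may be empty, so finite partitions are included.) -/
def IsPPoint {α : Type} (u : Ultrafilter α) : Prop :=
  (u : Filter α) ≤ Filter.cofinite ∧
    ∀ V : ℕ → Set α, Pairwise (Function.onFun Disjoint V) → (⋃ n, V n) = Set.univ →
      ∃ U ∈ u, (∃ n, U ⊆ V n) ∨ ∀ n, (U ∩ V n).Finite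

/-- The Rudin-Keisler preorder on filters: `G ≤ F` if some map `h` satisfies `h⁻¹(G) ⊆ F`. -/
def RKLE {α β : Type} (G : Filter β) (F : Filter α) : Prop :=
  ∃ h : α → β, ∀ S ∈ G, h ⁻¹' S ∈ F

/-- The P-points on `α`. -/
structure PPoint (α : Type) where
  toUltrafilter : Ultrafilter α
  isPPoint : IsPPoint toUltrafilter

/-- The P-points on `α`, preordered by the Rudin-Keisler relation. -/
instance PPoint.instPreorder (α : Type) : Preorder (PPoint α) where
  le p q := RKLE (p.toUltrafilter : Filter α) (q.toUltrafilter : Filter α)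
  le_refl _ := ⟨id, fun _ hS => hS⟩
  le_trans := by
    rintro p q r ⟨h, hh⟩ ⟨k, hk⟩
    exact ⟨h ∘ k, fun S hS => hk _ (hh S hS)⟩

/-- The map `h_ξ` on finitely supported functions `ℚ → ℕ`: `h_ξ(x)(r) = x(r)` if `r < ξ`, and
`h_ξ(x)(r) = 0` if `ξ ≤ r`. -/
noncomputable def truncBelow (ξ : ℝ) (x : ℚ →₀ ℕ) : ℚ →₀ ℕ :=
  x.filter (fun r : ℚ => (r : ℝ) < ξ)

/-! The sets of finitely supported functions on which some coordinate `x p` is a function of the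
coordinates below `p` generate a proper ideal: finitely many such predictions are evaded by choosing
the coordinates in increasing order. The dual filter is free, and it is `F_σ` because being
predicted in this way is a property of finite character.

Under `𝔡 = 𝔠`, which follows from `𝔟 = 𝔠`, every free `F_σ` filter on a countable set extends to a
P-point. Enumerate all functions `α → ℕ` in order type `𝔠` and add, one at a time, a set on which
the current function is constant or finite-to-one. For an `F_σ` filter, positivity of a set is
witnessed by a sequence of its finite subsets. Fewer than `𝔡` sequences matter at each stage, so
some function, telling how much of each fibre to keep, exceeds each of them infinitely often;
keeping that much preserves positivity.

Let `D` be such an extension. If `h` maps `h_η(D)` to `h_ξ(D)` and `η < ξ`, then `h ∘ h_η` maps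
`h_ξ(D)` to itself, so it is the identity almost everywhere (Katětov: a self-map without fixed
points admits a proper 3-colouring). Hence for any rational `p` between `η` and `ξ` the coordinate
`x p` is almost surely a function of those below `p`, which `D` forbids. -/

open Cardinal Filter Function Order Set
open scoped SetFamily

/-- The dominating number `𝔡`: the least cardinality of a family of functions `ℕ → ℕ` such that
every `g : ℕ → ℕ` is eventually bounded by some member of the family. -/
noncomputable def dominatingNumber : Cardinal.{0} :=
  sInf {κ : Cardinal.{0} | ∃ F : Set (ℕ → ℕ), #F = κ ∧
    ∀ g : ℕ → ℕ, ∃ f ∈ F, ∀ᶠ n in atTop, g n ≤ f n}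

theorem boundingNumber_le_dominatingNumber : boundingNumber ≤ dominatingNumber := by
  refine csInf_le_csInf' ⟨_, univ, rfl, fun g ↦ ⟨g, mem_univ g, .of_forall fun _ ↦ le_rfl⟩⟩ ?_
  rintro _ ⟨F, rfl, hF⟩
  refine ⟨F, rfl, fun ⟨g, hg⟩ ↦ ?_⟩
  obtain ⟨f, hfF, hgf⟩ := hF fun n ↦ g n + 1
  obtain ⟨n, hn, hn'⟩ := (hgf.and (hg f hfF)).exists
  omega

theorem dominatingNumber_le_continuum : dominatingNumber ≤ 𝔠 :=
  csInf_le' ⟨univ, by simp, fun g ↦ ⟨g, mem_univ g, .of_forall fun _ ↦ le_rfl⟩⟩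

theorem exists_monotone_frequently_lt {ι : Type} (f : ι → ℕ → ℕ) (hι : #ι < dominatingNumber) :
    ∃ g : ℕ → ℕ, Monotone g ∧ ∀ i, ∃ᶠ n in atTop, f i n < g n := by
  obtain ⟨g, hg⟩ : ∃ g : ℕ → ℕ, ∀ i, ∃ᶠ n in atTop, f i n < g n := by
    by_contra! h
    refine notMem_of_lt_csInf' (mk_range_le.trans_lt hι) ⟨range f, rfl, fun g ↦ ?_⟩
    obtain ⟨i, hi⟩ := h g
    exact ⟨f i, mem_range_self i, by simpa only [not_frequently, not_lt] using hi⟩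
  exact ⟨partialSups g, (partialSups g).monotone, fun i ↦
    (hg i).mono fun n hn ↦ hn.trans_le (le_partialSups g n)⟩

theorem mk_finite_sets_lt {α : Type*} {κ : Cardinal} (hκ : ℵ₀ ≤ κ) (hα : #α < κ) :
    #{s : Set α // s.Finite} < κ := by
  have hle : #{s : Set α // s.Finite} ≤ #(Finset α) :=
    mk_le_of_surjective (f := fun s : Finset α ↦ ⟨s, s.finite_toSet⟩)
      fun s ↦ ⟨s.2.toFinset, Subtype.ext s.2.coe_toFinset⟩
  refine hle.trans_lt ?_
  cases finite_or_infinite α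
  · exact (lt_aleph0_of_finite _).trans_le hκ
  · rwa [mk_finset_of_infinite]

namespace IsPPoint

theorem of_forall_constant_or_finite_fibers {α : Type} {u : Ultrafilter α}
    (hfree : (u : Filter α) ≤ cofinite)
    (h : ∀ v : α → ℕ, ∃ U ∈ u, (∃ n, U ⊆ v ⁻¹' {n}) ∨ ∀ n, (U ∩ v ⁻¹' {n}).Finite) :
    IsPPoint u := by
  refine ⟨hfree, fun V hdisj hcover ↦ ?_⟩
  choose v hv using iUnion_eq_univ_iff.1 hcover
  have hfiber : ∀ n, v ⁻¹' {n} = V n := fun n ↦ by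
    ext x
    refine ⟨fun h ↦ (show v x = n from h) ▸ hv x, fun h ↦ ?_⟩
    by_contra hne
    exact disjoint_left.1 (hdisj hne) (hv x) h
  simpa only [hfiber] using h v

theorem map {α β : Type} {u : Ultrafilter α} (hu : IsPPoint u) (f : α → β)
    (hfree : (u.map f : Filter β) ≤ cofinite) : IsPPoint (u.map f) := by
  refine ⟨hfree, fun V hdisj hcover ↦ ?_⟩
  obtain ⟨U, hU, h⟩ := hu.2 (fun n ↦ f ⁻¹' V n) (fun _ _ hij ↦ (hdisj hij).preimage f)
    (by rw [← preimage_iUnion, hcover, preimage_univ])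
  refine ⟨f '' U, image_mem_map hU, h.imp ?_ fun h n ↦ ?_⟩
  · rintro ⟨n, hn⟩
    exact ⟨n, image_subset_iff.2 hn⟩
  · rw [← image_inter_preimage]
    exact (h n).image f

end IsPPoint

section FiniteCharacter

variable {α : Type*}

theorem isLowerSet_of_isOfFiniteCharacter {𝒜 : Set (Set α)} (h𝒜 : IsOfFiniteCharacter 𝒜) :
    IsLowerSet 𝒜 := fun A _ hBA hA ↦
  (h𝒜 _).2 fun C hCB hC ↦ (h𝒜 A).1 hA C (hCB.trans hBA) hC

theorem isOfFiniteCharacter_singleton_empty : IsOfFiniteCharacter ({∅} : Set (Set α)) := by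
  refine fun A ↦ ⟨?_, fun h ↦ ?_⟩
  · rintro rfl B hB -
    exact subset_empty_iff.1 hB
  · exact eq_empty_of_forall_notMem fun x hx ↦
      singleton_ne_empty x (h {x} (singleton_subset_iff.2 hx) (finite_singleton x))

theorem isOfFiniteCharacter_sups {𝒜 ℬ : Set (Set α)} (h𝒜 : IsOfFiniteCharacter 𝒜)
    (hℬ : IsOfFiniteCharacter ℬ) : IsOfFiniteCharacter (𝒜 ⊻ ℬ) := by
  classical
  refine fun C ↦ ⟨?_, fun hC ↦ ?_⟩
  · rintro ⟨A, hA, B, hB, rfl⟩ D hD -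
    refine ⟨D ∩ A, isLowerSet_of_isOfFiniteCharacter h𝒜 inter_subset_right hA,
      D ∩ B, isLowerSet_of_isOfFiniteCharacter hℬ inter_subset_right hB, ?_⟩
    exact (inter_union_distrib_left D A B).symm.trans (inter_eq_left.2 hD)
  · -- By compactness, the splittings of the finite subsets of `C` glue to a splitting `χ` of `C`.
    have hsplit : ∀ t : Finset α, ∃ A ∈ 𝒜, ∃ B ∈ ℬ, A ∪ B = C ∩ t := fun t ↦
      hC _ inter_subset_left (t.finite_toSet.inter_of_right C)
    choose A hA B hB hAB using hsplit
    obtain ⟨χ, hχ⟩ := Finset.rado_selection (β := fun _ ↦ Prop) fun t x ↦ x ∈ A t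
    refine ⟨{x ∈ C | χ x}, (h𝒜 _).2 fun s hs hsfin ↦ ?_,
      {x ∈ C | ¬χ x}, (hℬ _).2 fun s hs hsfin ↦ ?_, by ext x; by_cases χ x <;> simp_all⟩
    · obtain ⟨t, -, ht⟩ := hχ hsfin.toFinset
      refine isLowerSet_of_isOfFiniteCharacter h𝒜 (fun x hx ↦ ?_) (hA t)
      exact ht x (hsfin.mem_toFinset.2 hx) ▸ (hs hx).2
    · obtain ⟨t, hst, ht⟩ := hχ hsfin.toFinset
      refine isLowerSet_of_isOfFiniteCharacter hℬ (fun x hx ↦ ?_) (hB t)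
      have hxs := hsfin.mem_toFinset.2 hx
      have hxAB : x ∈ A t ∪ B t := hAB t ▸ ⟨(hs hx).1, hst hxs⟩
      exact hxAB.resolve_left (ht x hxs ▸ (hs hx).2)

theorem isOfFiniteCharacter_exists_eqOn_comp {β γ : Type*} [Nonempty γ] (f : α → γ) (g : α → β) :
    IsOfFiniteCharacter {A : Set α | ∃ e : β → γ, EqOn f (e ∘ g) A} := by
  refine fun A ↦ ⟨fun ⟨e, he⟩ B hBA _ ↦ ⟨e, he.mono hBA⟩, fun h ↦ ?_⟩
  have hfactors : (A.domRestrict f).FactorsThrough (A.domRestrict g) := by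
    rintro ⟨x, hx⟩ ⟨y, hy⟩ hxy
    obtain ⟨e, he⟩ := h {x, y} (pair_subset hx hy) (toFinite _)
    exact (he (by simp)).trans ((congrArg e hxy).trans (he (by simp)).symm)
  obtain ⟨e, he⟩ := (factorsThrough_iff _).1 hfactors
  exact ⟨e, fun x hx ↦ congrFun he ⟨x, hx⟩⟩

theorem exists_finset_subset_forall_notMem {κ : Type*} {𝒦 : κ → Set (Set α)}
    (h𝒦 : ∀ k, IsOfFiniteCharacter (𝒦 k)) {A : Set α} (hA : ∀ k, A ∉ 𝒦 k) (s : Finset κ) :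
    ∃ t : Finset α, (t : Set α) ⊆ A ∧ ∀ k ∈ s, (t : Set α) ∉ 𝒦 k := by
  classical
  have hfin : ∀ k, ∃ t : Finset α, (t : Set α) ⊆ A ∧ (t : Set α) ∉ 𝒦 k := fun k ↦ by
    by_contra! h
    exact hA k ((h𝒦 k A).2 fun y hyA hy ↦ by simpa using h hy.toFinset (by simpa using hyA))
  choose t htA ht using hfin
  refine ⟨s.biUnion t, by simpa using fun k _ ↦ htA k, fun k hk hmem ↦ ht k ?_⟩
  exact isLowerSet_of_isOfFiniteCharacter (h𝒦 k)
    (Finset.coe_subset.2 (Finset.subset_biUnion_of_mem t hk)) hmem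

end FiniteCharacter

/-- `F` is an `F_σ` subset of the Cantor space `2^α`. The definition speaks about the dual ideal,
which for such `F` is a countable union of compact families closed under subsets; the compact
families closed under subsets are those of finite character. -/
def IsFSigmaFilter {α : Type*} (F : Filter α) : Prop :=
  ∃ 𝒦 : ℕ → Set (Set α), (∀ n, IsOfFiniteCharacter (𝒦 n)) ∧ ∀ A, Aᶜ ∈ F ↔ ∃ n, A ∈ 𝒦 n

section FiniteUnions

variable {α ι : Type*} {𝒜 : ι → Set (Set α)}

/-- The sets `A₁ ∪ ⋯ ∪ Aₙ` with `Aₖ ∈ 𝒜 iₖ`, where `l = [i₁, …, iₙ]`. For countable `ι` these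
families present the ideal generated by `⋃ i, 𝒜 i` as a countable union. -/
def listUnions (𝒜 : ι → Set (Set α)) (l : List ι) : Set (Set α) :=
  l.foldr (fun i ℬ ↦ 𝒜 i ⊻ ℬ) {∅}

theorem isOfFiniteCharacter_listUnions (h𝒜 : ∀ i, IsOfFiniteCharacter (𝒜 i)) (l : List ι) :
    IsOfFiniteCharacter (listUnions 𝒜 l) := by
  induction l with
  | nil => exact isOfFiniteCharacter_singleton_empty
  | cons i l ih => exact isOfFiniteCharacter_sups (h𝒜 i) ih

theorem union_mem_listUnions_append {l l' : List ι} {A B : Set α} (hA : A ∈ listUnions 𝒜 l)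
    (hB : B ∈ listUnions 𝒜 l') : A ∪ B ∈ listUnions 𝒜 (l ++ l') := by
  induction l generalizing A with
  | nil => rwa [show A = ∅ from hA, empty_union]
  | cons i l ih =>
    obtain ⟨C, hC, D, hD, rfl⟩ := hA
    exact ⟨C, hC, D ∪ B, ih hD, (union_assoc C D B).symm⟩

theorem compl_mem_generate_of_mem_listUnions {l : List ι} {A : Set α} (hA : A ∈ listUnions 𝒜 l) :
    Aᶜ ∈ generate {B | ∃ i, Bᶜ ∈ 𝒜 i} := by
  induction l generalizing A with
  | nil => rw [show A = ∅ from hA, compl_empty]; exact univ_mem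
  | cons i l ih =>
    obtain ⟨B, hB, C, hC, rfl⟩ := hA
    rw [sup_eq_union, compl_union]
    exact inter_mem (mem_generate_of_mem ⟨i, by rwa [compl_compl]⟩) (ih hC)

theorem exists_compl_mem_listUnions (h𝒜 : ∀ i, IsOfFiniteCharacter (𝒜 i)) {A : Set α}
    (hA : A ∈ generate {B | ∃ i, Bᶜ ∈ 𝒜 i}) : ∃ l, Aᶜ ∈ listUnions 𝒜 l := by
  induction hA with
  | basic hA =>
    obtain ⟨i, hi⟩ := hA
    exact ⟨[i], _, hi, ∅, rfl, union_empty _⟩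
  | univ => exact ⟨[], compl_univ⟩
  | superset _ hAB ih =>
    obtain ⟨l, hl⟩ := ih
    exact ⟨l, isLowerSet_of_isOfFiniteCharacter (isOfFiniteCharacter_listUnions h𝒜 l)
      (compl_subset_compl.2 hAB) hl⟩
  | inter _ _ ihA ihB =>
    obtain ⟨l, hl⟩ := ihA
    obtain ⟨l', hl'⟩ := ihB
    exact ⟨l ++ l', compl_inter _ _ ▸ union_mem_listUnions_append hl hl'⟩

theorem isFSigmaFilter_generate_compl [Countable ι] (h𝒜 : ∀ i, IsOfFiniteCharacter (𝒜 i)) :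
    IsFSigmaFilter (generate {B | ∃ i, Bᶜ ∈ 𝒜 i}) := by
  obtain ⟨l, hl⟩ := exists_surjective_nat (List ι)
  refine ⟨listUnions 𝒜 ∘ l, fun n ↦ isOfFiniteCharacter_listUnions h𝒜 (l n), fun A ↦ ⟨fun hA ↦ ?_,
    fun ⟨n, hn⟩ ↦ compl_mem_generate_of_mem_listUnions hn⟩⟩
  obtain ⟨l', hl'⟩ := exists_compl_mem_listUnions h𝒜 hA
  obtain ⟨n, rfl⟩ := hl l'
  exact ⟨n, by rwa [compl_compl] at hl'⟩

end FiniteUnions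

theorem exists_finite_fibers {α ι : Type} [Countable α] {F G : Filter α} (hF : IsFSigmaFilter F)
    {p : ι → Prop} {s : ι → Set α} (hG : G.HasBasis p s) (hp : #{i // p i} < dominatingNumber)
    (hFG : (F ⊓ G).NeBot) {v : α → ℕ} (hv : Tendsto v (F ⊓ G) atTop) :
    ∃ U : Set α, (F ⊓ G ⊓ 𝓟 U).NeBot ∧ ∀ n, (U ∩ v ⁻¹' {n}).Finite := by
  obtain ⟨𝒦, h𝒦, hsmall⟩ := hF
  have hlarge : ∀ (i : {i // p i}) n k, s i ∩ {x | n ≤ v x} ∉ 𝒦 k := fun i n k hk ↦ by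
    have hF := mem_inf_of_left (g := G) ((hsmall _).2 ⟨k, hk⟩)
    have hG := mem_inf_of_right (f := F) (hG.mem_of_mem i.2)
    obtain ⟨x, ⟨hx, hxs⟩, hxv⟩ :=
      hFG.nonempty_of_mem (inter_mem (inter_mem hF hG) (hv.eventually_ge_atTop n))
    exact hx ⟨hxs, hxv⟩
  choose t hts ht using fun i n ↦
    exists_finset_subset_forall_notMem h𝒦 (hlarge i n) (Finset.Iic n)
  obtain ⟨enum, henum⟩ := exists_injective_nat α
  obtain ⟨g, hgmono, hg⟩ := exists_monotone_frequently_lt (fun i n ↦ (t i n).sup enum) hp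
  refine ⟨{x | enum x ≤ g (v x)}, ⟨fun hbot ↦ ?_⟩, fun n ↦ ?_⟩
  · obtain ⟨A, hA, B, hB, hAB⟩ := mem_inf_iff.1 (inf_principal_eq_bot.1 hbot)
    obtain ⟨i, hi, hiB⟩ := hG.mem_iff.1 hB
    have hdisj : A ⊆ (s i ∩ {x | enum x ≤ g (v x)})ᶜ := fun x hxA ⟨hxs, hxU⟩ ↦
      (hAB ▸ ⟨hxA, hiB hxs⟩ : x ∈ {x | enum x ≤ g (v x)}ᶜ) hxU
    obtain ⟨k, hk⟩ := (hsmall _).1 (mem_of_superset hA hdisj)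
    obtain ⟨n, hn, hkn⟩ := ((hg ⟨i, hi⟩).and_eventually (eventually_ge_atTop k)).exists
    refine ht ⟨i, hi⟩ n k (Finset.mem_Iic.2 hkn)
      (isLowerSet_of_isOfFiniteCharacter (h𝒦 k) (fun x hx ↦ ?_) hk)
    obtain ⟨hxs, hxv⟩ := hts ⟨i, hi⟩ n hx
    exact ⟨hxs, (Finset.le_sup (f := enum) hx).trans (hn.le.trans (hgmono hxv))⟩
  · refine ((finite_Iic (g n)).preimage henum.injOn).subset ?_
    rintro x ⟨hx, rfl⟩
    exact hx

theorem exists_constant_or_finite_fibers {α ι : Type} [Countable α] {F G : Filter α}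
    (hF : IsFSigmaFilter F) {p : ι → Prop} {s : ι → Set α} (hG : G.HasBasis p s)
    (hp : #{i // p i} < dominatingNumber) (hFG : (F ⊓ G).NeBot) (v : α → ℕ) :
    ∃ U : Set α, (F ⊓ G ⊓ 𝓟 U).NeBot ∧
      ((∃ n, U ⊆ v ⁻¹' {n}) ∨ ∀ n, (U ∩ v ⁻¹' {n}).Finite) := by
  by_cases hconst : ∃ n, (F ⊓ G ⊓ 𝓟 (v ⁻¹' {n})).NeBot
  · obtain ⟨n, hn⟩ := hconst
    exact ⟨_, hn, .inl ⟨n, subset_rfl⟩⟩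
  · have hv : Tendsto v (F ⊓ G) atTop := by
      simp only [not_exists, not_neBot, inf_principal_eq_bot] at hconst
      rw [← Nat.cofinite_eq_atTop]
      exact le_cofinite_iff_compl_singleton_mem.2 hconst
    obtain ⟨U, hU, hfin⟩ := exists_finite_fibers hF hG hp hFG hv
    exact ⟨U, hU, .inr hfin⟩

section Transfinite

theorem exists_forall_domRestrict_Iio {ι : Type*} [Preorder ι] [WellFoundedLT ι] {β : Type*}
    [Nonempty β] (R : ∀ i, (Iio i → β) → β → Prop)
    (hR : ∀ i (f : ι → β), (∀ j < i, R j ((Iio j).domRestrict f) (f j)) →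
      ∃ b, R i ((Iio i).domRestrict f) b) :
    ∃ f : ι → β, ∀ i, R i ((Iio i).domRestrict f) (f i) := by
  let step (i : ι) (prev : ∀ j, j < i → β) : β := Classical.epsilon (R i fun j ↦ prev j j.2)
  let f : ι → β := wellFounded_lt.fix step
  refine ⟨f, fun i ↦ ?_⟩
  induction i using WellFoundedLT.induction with
  | _ i ih =>
    rw [show f i = step i fun j _ ↦ f j from wellFounded_lt.fix_eq step i]
    exact Classical.epsilon_spec (hR i f ih)

variable {ι : Type*} [LinearOrder ι]

theorem neBot_inf_iInf_of_forall_Iio {α : Type*} {F : Filter α} [F.NeBot] (G : ι → Filter α)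
    (s : Set ι) (h : ∀ i ∈ s, (F ⊓ (⨅ j : Iio i, G j) ⊓ G i).NeBot) :
    (F ⊓ ⨅ i : s, G i).NeBot := by
  rcases isEmpty_or_nonempty s with hs | hs
  · simpa only [iInf_of_empty, inf_top_eq]
  have hanti : Antitone fun i : s ↦ F ⊓ (⨅ j : Iio (i : ι), G j) ⊓ G i := by
    intro i k hik
    rcases hik.eq_or_lt with rfl | hik
    · rfl
    · refine inf_le_left.trans (le_inf (inf_le_inf_left F ?_) ?_)
      · exact le_iInf fun j ↦ iInf_le (fun j : Iio (k : ι) ↦ G j) ⟨j, lt_trans j.2 hik⟩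
      · exact inf_le_right.trans (iInf_le (fun j : Iio (k : ι) ↦ G j) ⟨i, hik⟩)
  refine (iInf_neBot_of_directed' hanti.directed_ge fun i ↦ h i i.2).mono ?_
  rw [inf_iInf]
  exact iInf_mono fun i ↦ inf_le_inf_right _ inf_le_left

theorem exists_forall_neBot_inf_iInf_principal [WellFoundedLT ι] {α : Type*} {F : Filter α}
    [F.NeBot] (P : ι → Set α → Prop)
    (hP : ∀ i (V : Iio i → Set α), (F ⊓ ⨅ j, 𝓟 (V j)).NeBot →
      ∃ U, (F ⊓ (⨅ j, 𝓟 (V j)) ⊓ 𝓟 U).NeBot ∧ P i U) :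
    ∃ U : ι → Set α, (∀ i, P i (U i)) ∧ (F ⊓ ⨅ i, 𝓟 (U i)).NeBot := by
  obtain ⟨U, hU⟩ := exists_forall_domRestrict_Iio
    (fun i (V : Iio i → Set α) U ↦ (F ⊓ (⨅ j, 𝓟 (V j)) ⊓ 𝓟 U).NeBot ∧ P i U)
    fun i V hV ↦ hP i _ (neBot_inf_iInf_of_forall_Iio (𝓟 ∘ V) (Iio i) fun j hj ↦ (hV j hj).1)
  refine ⟨U, fun i ↦ (hU i).2, ?_⟩
  simpa [iInf_subtype] using neBot_inf_iInf_of_forall_Iio (𝓟 ∘ U) univ fun i _ ↦ (hU i).1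

end Transfinite

theorem IsFSigmaFilter.exists_isPPoint_le {α : Type} [Countable α] {F : Filter α} [F.NeBot]
    (hF : IsFSigmaFilter F) (hfree : F ≤ cofinite) (h𝔡 : dominatingNumber = 𝔠) :
    ∃ u : Ultrafilter α, IsPPoint u ∧ (u : Filter α) ≤ F := by
  have : Infinite α := by
    by_contra hfin
    rw [not_infinite_iff_finite] at hfin
    exact NeBot.ne ‹F.NeBot› (le_bot_iff.1 (hfree.trans_eq cofinite_eq_bot))
  let ι := continuum.{0}.ord.ToType
  have hι : #ι = 𝔠 := mk_ord_toType 𝔠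
  obtain ⟨v⟩ : Nonempty (ι ≃ (α → ℕ)) := Cardinal.eq.1 (by simp [hι])
  have hsmall (i : ι) : #{s : Set (Iio i) // s.Finite} < dominatingNumber := by
    rw [h𝔡]
    exact mk_finite_sets_lt aleph0_le_continuum ((mk_Iio_lt i (by simp [ι])).trans_eq hι)
  obtain ⟨U, hU, hne⟩ := exists_forall_neBot_inf_iInf_principal (F := F)
    (fun i U ↦ (∃ n, U ⊆ v i ⁻¹' {n}) ∨ ∀ n, (U ∩ v i ⁻¹' {n}).Finite)
    fun i V hV ↦ exists_constant_or_finite_fibers hF (hasBasis_iInf_principal_finite V)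
      (hsmall i) hV (v i)
  have hle := Ultrafilter.of_le (F ⊓ ⨅ i, 𝓟 (U i))
  refine ⟨Ultrafilter.of (F ⊓ ⨅ i, 𝓟 (U i)), .of_forall_constant_or_finite_fibers ?_ ?_, ?_⟩
  · exact hle.trans (inf_le_left.trans hfree)
  · intro w
    obtain ⟨i, rfl⟩ := v.surjective w
    exact ⟨U i, hle (mem_inf_of_right (mem_iInf_of_mem i (mem_principal_self _))), hU i⟩
  · exact hle.trans inf_le_left

section FixedPoints

variable {α : Type*} (f : α → α)

theorem exists_fin_three_coloring_finset (t : Finset α) :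
    ∃ c : α → Fin 3, ∀ x ∈ t, f x ∈ t → f x ≠ x → c (f x) ≠ c x := by
  classical
  induction t using Finset.strongInduction with
  | _ t ih =>
    rcases t.eq_empty_or_nonempty with rfl | hne
    · exact ⟨0, by simp⟩
    obtain ⟨y, hy, hfiber⟩ := Finset.exists_card_fiber_le_of_card_le_mul (f := f) hne
      (mul_one t.card).ge
    -- `y` has at most one preimage in `t`, so it must avoid at most two colours.
    obtain ⟨c, hc⟩ := ih (t.erase y) (Finset.erase_ssubset hy)
    obtain ⟨k, -, hk⟩ : ∃ k ∈ Finset.univ, k ∉ insert (c (f y)) ({x ∈ t | f x = y}.image c) := by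
      refine Finset.exists_mem_notMem_of_card_lt_card ((Finset.card_insert_le _ _).trans_lt ?_)
      have := Finset.card_image_le (s := {x ∈ t | f x = y}) (f := c)
      simp only [Finset.card_univ, Fintype.card_fin]
      omega
    simp only [Finset.mem_insert, Finset.mem_image, Finset.mem_filter, not_or, not_exists] at hk
    refine ⟨update c y k, fun x hx hfx hne ↦ ?_⟩
    rcases eq_or_ne x y with rfl | hxy
    · simpa [update_of_ne hne] using Ne.symm hk.1
    rcases eq_or_ne (f x) y with hfy | hfy
    · rw [hfy, update_self, update_of_ne hxy]
      exact fun h ↦ hk.2 x ⟨⟨hx, hfy⟩, h.symm⟩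
    · rw [update_of_ne hfy, update_of_ne hxy]
      exact hc x (Finset.mem_erase.2 ⟨hxy, hx⟩) (Finset.mem_erase.2 ⟨hfy, hfx⟩) hne

theorem exists_fin_three_coloring :
    ∃ c : α → Fin 3, ∀ x, f x ≠ x → c (f x) ≠ c x := by
  classical
  choose c hc using exists_fin_three_coloring_finset f
  obtain ⟨χ, hχ⟩ := Finset.rado_selection (β := fun _ ↦ Fin 3) c
  refine ⟨χ, fun x hx ↦ ?_⟩
  obtain ⟨t, hst, ht⟩ := hχ {x, f x}
  rw [ht x (by simp), ht (f x) (by simp)]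
  exact hc t x (hst (by simp)) (hst (by simp)) hx

variable {f}

theorem eventually_eq_self_of_map_eq {u : Ultrafilter α} (h : u.map f = u) :
    ∀ᶠ x in (u : Filter α), f x = x := by
  obtain ⟨c, hc⟩ := exists_fin_three_coloring f
  obtain ⟨k, hk⟩ := (u.map c).eq_pure_of_finite
  have hck : ∀ᶠ x in (u : Filter α), c x = k := by
    change {k} ∈ u.map c
    exact hk ▸ rfl
  have hcfk : ∀ᶠ x in (u : Filter α), c (f x) = k := by
    rw [← h] at hck
    exact hck
  filter_upwards [hck, hcfk] with x hx hfx
  exact not_imp_comm.1 (hc x) (not_not.2 (hfx.trans hx.symm))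

end FixedPoints

namespace PPoint

variable {α β : Type}

theorem le_iff {p q : PPoint α} : p ≤ q ↔ ∃ h, q.toUltrafilter.map h = p.toUltrafilter :=
  exists_congr fun _ ↦ ⟨fun h ↦ Ultrafilter.eq_of_le h, fun h ↦ Ultrafilter.coe_le_coe.2 h⟩

/-- The image of a P-point under an injection. -/
def map (e : α ↪ β) (p : PPoint α) : PPoint β where
  toUltrafilter := p.toUltrafilter.map e
  isPPoint := p.isPPoint.map e ((map_mono p.isPPoint.1).trans e.injective.tendsto_cofinite)

theorem map_le_map_iff (e : α ↪ β) {p q : PPoint α} : p.map e ≤ q.map e ↔ p ≤ q := by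
  have : Nonempty α := nonempty_of_neBot (p.toUltrafilter : Filter α)
  have hinv : invFun e ∘ e = id := invFun_comp e.injective
  simp only [le_iff, map, Ultrafilter.map_map]
  constructor
  · rintro ⟨h, hh⟩
    refine ⟨invFun e ∘ h ∘ e, ?_⟩
    rw [← Ultrafilter.map_map, hh, Ultrafilter.map_map, hinv, Ultrafilter.map_id]
  · rintro ⟨h, hh⟩
    refine ⟨e ∘ h ∘ invFun e, ?_⟩
    rw [comp_assoc, comp_assoc, hinv, comp_id, ← Ultrafilter.map_map, hh]

end PPoint

section TruncBelow

theorem truncBelow_apply_of_lt {ξ : ℝ} {r : ℚ} (h : (r : ℝ) < ξ) (x : ℚ →₀ ℕ) :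
    truncBelow ξ x r = x r := by
  classical
  exact Finsupp.filter_apply_pos _ x h

theorem truncBelow_truncBelow {ξ η : ℝ} (h : ξ ≤ η) (x : ℚ →₀ ℕ) :
    truncBelow ξ (truncBelow η x) = truncBelow ξ x := by
  classical
  ext r
  simp only [truncBelow, Finsupp.filter_apply]
  grind

theorem truncBelow_update_of_le {ξ : ℝ} {r : ℚ} (h : ξ ≤ r) (x : ℚ →₀ ℕ) (n : ℕ) :
    truncBelow ξ (x.update r n) = truncBelow ξ x := by
  classical
  ext s
  simp only [truncBelow, Finsupp.filter_apply, Finsupp.update_apply]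
  grind

theorem exists_forall_apply_ne {ι : Type*} [Finite ι] (p : ι → ℚ) (g : ι → (ℚ →₀ ℕ) → ℕ) :
    ∃ x : ℚ →₀ ℕ, ∀ i, x (p i) ≠ g i (truncBelow (p i) x) := by
  classical
  cases nonempty_fintype ι
  suffices h : ∀ t : Finset ℚ, ∃ x : ℚ →₀ ℕ, ∀ i, p i ∈ t → x (p i) ≠ g i (truncBelow (p i) x) by
    obtain ⟨x, hx⟩ := h (Finset.univ.image p)
    exact ⟨x, fun i ↦ hx i (by simp)⟩
  intro t
  induction t using Finset.induction_on_max with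
  | empty => exact ⟨0, by simp⟩
  | insert r t hr ih =>
    obtain ⟨x, hx⟩ := ih
    obtain ⟨n, hn⟩ := (finite_range fun i ↦ g i (truncBelow r x)).exists_notMem
    refine ⟨x.update r n, fun i hi ↦ ?_⟩
    rcases Finset.mem_insert.1 hi with h | h
    · rw [h, truncBelow_update_of_le le_rfl, Finsupp.update_apply, if_pos rfl]
      exact fun hin ↦ hn ⟨i, hin.symm⟩
    · have hlt := hr _ h
      rw [truncBelow_update_of_le (by exact_mod_cast hlt.le), Finsupp.update_apply, if_neg hlt.ne]
      exact hx i h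

end TruncBelow

/-- `F` is unpredictable if no coordinate is `F`-almost surely a function of the lower ones. For an
ultrafilter this is what makes `ξ ↦ truncBelow ξ` strictly increasing in the Rudin-Keisler order. -/
def IsUnpredictable (F : Filter (ℚ →₀ ℕ)) : Prop :=
  ∀ (p : ℚ) (g : (ℚ →₀ ℕ) → ℕ), ∀ᶠ x in F, x p ≠ g (truncBelow p x)

theorem exists_isFSigmaFilter_isUnpredictable :
    ∃ F : Filter (ℚ →₀ ℕ), F.NeBot ∧ IsFSigmaFilter F ∧ IsUnpredictable F := by
  let 𝒜 (p : ℚ) : Set (Set (ℚ →₀ ℕ)) := {A | ∃ g : (ℚ →₀ ℕ) → ℕ, EqOn (· p) (g ∘ truncBelow p) A}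
  refine ⟨generate {B | ∃ p, Bᶜ ∈ 𝒜 p}, generate_neBot_iff.2 fun T hT hTfin ↦ ?_,
    isFSigmaFilter_generate_compl fun p ↦ isOfFiniteCharacter_exists_eqOn_comp (· p) (truncBelow p),
    fun p g ↦ mem_generate_of_mem ⟨p, g, fun x hx ↦ not_not.1 hx⟩⟩
  choose p g hpg using fun B : T ↦ hT B.2
  have := hTfin.to_subtype
  obtain ⟨x, hx⟩ := exists_forall_apply_ne p g
  exact ⟨x, fun B hB ↦ not_not.1 fun hxB ↦ hx ⟨B, hB⟩ (hpg ⟨B, hB⟩ hxB)⟩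

namespace IsUnpredictable

theorem tendsto_truncBelow_cofinite {F : Filter (ℚ →₀ ℕ)} (hF : IsUnpredictable F) (ξ : ℝ) :
    Tendsto (truncBelow ξ) F cofinite := by
  refine le_cofinite_iff_compl_singleton_mem.2 fun a ↦ ?_
  obtain ⟨p, hp⟩ := exists_rat_lt ξ
  rw [mem_map]
  filter_upwards [hF p fun _ ↦ a p] with x hx (h : truncBelow ξ x = a)
  exact hx (h ▸ (truncBelow_apply_of_lt hp x).symm)

theorem le_cofinite {F : Filter (ℚ →₀ ℕ)} (hF : IsUnpredictable F) : F ≤ cofinite :=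
  le_cofinite_iff_compl_singleton_mem.2 fun a ↦
    mem_of_superset (hF 0 fun _ ↦ a 0) fun _ hx h ↦ hx (congrArg (· 0) h)

variable {D : Ultrafilter (ℚ →₀ ℕ)}

theorem exists_map_truncBelow_eq_iff (hD : IsUnpredictable (D : Filter (ℚ →₀ ℕ))) {ξ η : ℝ} :
    (∃ h, (D.map (truncBelow η)).map h = D.map (truncBelow ξ)) ↔ ξ ≤ η := by
  refine ⟨fun ⟨h, hh⟩ ↦ ?_, fun hle ↦ ⟨truncBelow ξ, ?_⟩⟩
  · by_contra! hlt
    obtain ⟨p, hηp, hpξ⟩ := exists_rat_btwn hlt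
    have hcomp : truncBelow η ∘ truncBelow ξ = truncBelow η := funext (truncBelow_truncBelow hlt.le)
    have hfix : (D.map (truncBelow ξ)).map (h ∘ truncBelow η) = D.map (truncBelow ξ) := by
      rw [← Ultrafilter.map_map, Ultrafilter.map_map D, hcomp, hh]
    have hfixed : ∀ᶠ x in (D : Filter _), h (truncBelow η (truncBelow ξ x)) = truncBelow ξ x :=
      eventually_eq_self_of_map_eq hfix
    obtain ⟨x, hx, hne⟩ := (hfixed.and (hD p fun z ↦ h (truncBelow η z) p)).exists
    rw [truncBelow_truncBelow hlt.le] at hx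
    rw [truncBelow_truncBelow hηp.le, hx, truncBelow_apply_of_lt hpξ] at hne
    exact hne rfl
  · rw [Ultrafilter.map_map]
    exact congrArg D.map (funext (truncBelow_truncBelow hle))

end IsUnpredictable

theorem exists_isPPoint_isUnpredictable (h𝔡 : dominatingNumber = 𝔠) :
    ∃ D : Ultrafilter (ℚ →₀ ℕ), IsPPoint D ∧ IsUnpredictable (D : Filter (ℚ →₀ ℕ)) := by
  obtain ⟨F, hne, hF, hunp⟩ := exists_isFSigmaFilter_isUnpredictable
  obtain ⟨D, hD, hDF⟩ := hF.exists_isPPoint_le hunp.le_cofinite h𝔡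
  exact ⟨D, hD, fun p g ↦ (hunp p g).filter_mono hDF⟩

theorem mainTheorem4_general (h𝔡 : dominatingNumber = 𝔠) :
    ∃ D : PPoint (ℚ →₀ ℕ),
      (∃ Φ : ℝ ↪o PPoint (ℚ →₀ ℕ), ∀ ξ : ℝ,
        (Φ ξ).toUltrafilter = D.toUltrafilter.map (truncBelow ξ)) ∧
      ∃ (e : (ℚ →₀ ℕ) ≃ ℕ) (Ψ : ℝ ↪o PPoint ℕ), ∀ ξ : ℝ,
        (Ψ ξ).toUltrafilter = (D.toUltrafilter.map (truncBelow ξ)).map e := by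
  obtain ⟨D, hD, hunp⟩ := exists_isPPoint_isUnpredictable h𝔡
  let Φ : ℝ ↪o PPoint (ℚ →₀ ℕ) := .ofMapLEIff
    (fun ξ ↦ ⟨D.map (truncBelow ξ), hD.map _ (hunp.tendsto_truncBelow_cofinite ξ)⟩)
    fun _ _ ↦ PPoint.le_iff.trans hunp.exists_map_truncBelow_eq_iff
  obtain ⟨e⟩ := nonempty_equiv_of_countable (α := ℚ →₀ ℕ) (β := ℕ)
  let Ψ : ℝ ↪o PPoint ℕ := .ofMapLEIff (fun ξ ↦ (Φ ξ).map e.toEmbedding)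
    fun _ _ ↦ (PPoint.map_le_map_iff _).trans Φ.le_iff_le
  exact ⟨⟨D, hD⟩, ⟨Φ, fun _ ↦ rfl⟩, e, Ψ, fun _ ↦ rfl⟩

theorem mainTheorem4 (hbc : boundingNumber = Cardinal.continuum) :
    ∃ D : PPoint (ℚ →₀ ℕ),
      (∃ Φ : ℝ ↪o PPoint (ℚ →₀ ℕ), ∀ ξ : ℝ,
        (Φ ξ).toUltrafilter = D.toUltrafilter.map (truncBelow ξ)) ∧
      ∃ (e : (ℚ →₀ ℕ) ≃ ℕ) (Ψ : ℝ ↪o PPoint ℕ), ∀ ξ : ℝ,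
        (Ψ ξ).toUltrafilter = (D.toUltrafilter.map (truncBelow ξ)).map e :=
  mainTheorem4_general <|
    dominatingNumber_le_continuum.antisymm (hbc ▸ boundingNumber_le_dominatingNumber)
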